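/- Let $k$ be a field and $G$ a (discrete) group. An $E_\infty$-algebra is an algebra over the (unital) Barratt–Eccles operad in unbounded differential graded vector spaces over $k$; the category of these is denoted $E_\infty\text{-}\mathsf{Alg}$. It is tensored over simplicial sets: morphisms $K\otimes A\to B$ are the morphisms $A\to B^K=\mathrm{Hom}(N_*(K;k),B)$, where the operad acts on $B^K$ through its Alexander–Whitney diagonal and its standard (Berger–Fresse) action on normalized chains. A $G$-equivariant $E_\infty$-algebra is a functor $A:\star/\!/G\to E_\infty\text{-}\mathsf{Alg}$, and $QA\to A$ denotes a cofibrant replacement of $A$ as an $E_\infty$-algebra, on which $G$ acts compatibly (weak equivalences are the quasi-isomorphisms, fibrations the degreewise surjections). A space is a simplicial set. A $G$-bundle over a simplicial set $Y$ is a simplicial set $P$ with right $G$-action and an invariant map $P\to Y$ whose fibres in each simplicial degree are nonempty, free and transitive $G$-sets. For such $P$ put $$\int_P A:=P\overset{\mathbb L}{\otimes}_G A=\int^{[n]\in\Delta}\bigl(P\times\Delta_n\times G^n\bigr)\otimes QA\ \in E_\infty\text{-}\mathsf{Alg},$$ the realization of the two-sided bar construction $B_*(P,\star/\!/G,QA)$.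 Let $\Phi:X\to Y$ be an isomorphism of simplicial sets, $P$ a $G$-bundle over $Y$, and $A$ a $G$-equivariant $E_\infty$-algebra. Then, for every choice of $QA$, the morphism $\int_{\Phi^*P}A\to\int_P A$ induced by the canonical $G$-equivariant projection $\Phi^*P=X\times_Y P\to P$ is an isomorphism of $E_\infty$-algebras. Consequently, equivariant higher Hochschild chains are essentially constant on mapping class group orbits: if $P$ and $P'$ are $G$-bundles over a simplicial set $X$ whose isomorphism classes lie in the same orbit of the mapping class group of $X$, i.e. $P'\cong\Phi^*P$ as $G$-bundles for some automorphism $\Phi$ of $X$, then $\int_P A\cong\int_{P'}A$ for every $G$-equivariant $E_\infty$-algebra $A$. -/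

import Mathlib

open CategoryTheory Opposite

universe u

/-! ## The Barratt–Eccles operad: permutations, shuffles, and the action on simplicial chains

A permutation `w : Equiv.Perm (Fin r)` is read as the sequence `w 0, w 1, …, w (r - 1)` of its
values.  In arity `r` and degree `d` the Barratt–Eccles operad `E` is spanned by the sequences
`(w 0, …, w d)` of permutations of `Fin r`, modulo those with two equal consecutive entries; that
is, `E r` is the complex of normalized chains of the simplicial set `[d] ↦ (Perm (Fin r))^(d+1)`. -/

namespace BarrattEccles

/-- The composition `u(v 0, …, v (r-1))` in the operad of permutations: in the sequence `u`, the
value `i` is replaced by the sequence `v i`, its values being shifted into the `i`-th block. -/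
def permComp {r : ℕ} (s : Fin r → ℕ) (u : Equiv.Perm (Fin r))
    (v : ∀ i, Equiv.Perm (Fin (s i))) : Equiv.Perm (Fin (∑ i, s i)) :=
  (finCongr (Equiv.sum_comp u s).symm).trans
    (finSigmaFinEquiv.symm.trans
      ((Equiv.sigmaCongr u (fun p => v (u p))).trans finSigmaFinEquiv))

/-- The shuffles: the nondegenerate simplices of maximal dimension `N = D 0 + ⋯ + D (a-1)` of the
product of the standard simplices of dimensions `D 0, …, D (a-1)`. -/
abbrev Shuffle {a : ℕ} (D : Fin a → ℕ) (N : ℕ) : Type :=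
  {x : Fin (N + 1) → ∀ c, Fin (D c + 1) // StrictMono x}

noncomputable instance {a : ℕ} (D : Fin a → ℕ) (N : ℕ) : Fintype (Shuffle D N) :=
  Fintype.ofFinite _

/-- The exponent of the sign of a shuffle: the number of pairs of steps of the path `x` in which
a step in direction `c'` precedes a step in direction `c`, for `c < c'`. -/
def shuffleExponent {a : ℕ} {D : Fin a → ℕ} {N : ℕ} (x : Shuffle D N) : ℕ :=
  ∑ t : Fin N, ∑ c : Fin a, ∑ c' : Fin a,
    if c < c' then
      ((x.1 t.succ c : ℕ) - (x.1 t.castSucc c : ℕ)) * (x.1 t.castSucc c' : ℕ) else 0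

/-- The dimensions of the factors of a composition in the Barratt–Eccles operad. -/
def compDims {r : ℕ} (d : ℕ) (e : Fin r → ℕ) : Fin (r + 1) → ℕ := Fin.cons d e

/-- The simplex of `E (∑ i, s i)` that the shuffle `x` contributes to the composition
`u(v 0, …, v (r-1))`. -/
def compSimplex {r d : ℕ} {s e : Fin r → ℕ} (u : Fin (d + 1) → Equiv.Perm (Fin r))
    (v : ∀ i, Fin (e i + 1) → Equiv.Perm (Fin (s i)))
    (x : Shuffle (compDims d e) (d + ∑ i, e i)) :
    Fin (d + ∑ i, e i + 1) → Equiv.Perm (Fin (∑ i, s i)) :=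
  fun t => permComp s (u (x.1 t 0)) (fun i => v i (x.1 t i.succ))

/-- The table reduction map from the Barratt–Eccles operad to the surjection operad.
A simplex of `E r` is given by the list of its permutations, each of them as a list of values.
The output lists the surjections (as sequences of values) whose sum is the image; an entry
of the sequence comes with the Boolean `true` if it is not the last occurrence of its
value in that sequence, and with `false` if it is. Each row but the last one consists of `t + 1`
entries of the current permutation, and the first `t` of them are deleted from all later ones. -/
def tableReduction {α : Type} [DecidableEq α] : List (List α) → List (List (α × Bool))
  | [] => []
  | [w] => [w.map fun a => (a, false)]
  | w :: w' :: ws =>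
    (List.range w.length).flatMap fun t =>
      (tableReduction ((w' :: ws).map fun l => l.filter fun a => a ∉ w.take t)).map fun s =>
        (w.take t).map (fun a => (a, false)) ++ ((w.drop t).take 1).map (fun a => (a, true)) ++ s
termination_by l => l.length

/-- The ways of cutting the interval `{p, …, n}` into consecutive intervals `{lo, …, hi}` (two
neighbours share one endpoint) labelled by the entries of the given sequence. -/
def intervalCuts {β : Type} (n : ℕ) : ℕ → List β → List (List (β × ℕ × ℕ))
  | p, [] => if p = n then [[]] else []
  | p, b :: s => (List.range' p (n + 1 - p)).flatMap fun q =>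
      (intervalCuts n q s).map fun c => (b, p, q) :: c

/-- The vertices of the intervals labelled by `i`. -/
def cutVertices {α : Type} [DecidableEq α] (i : α) (c : List ((α × Bool) × ℕ × ℕ)) : List ℕ :=
  (c.filter fun z => z.1.1 = i).flatMap fun z => List.range' z.2.1 (z.2.2 + 1 - z.2.1)

/-- The degree of a labelled interval: its length, plus one if its label occurs again later. -/
def cutDegree {α : Type} (z : (α × Bool) × ℕ × ℕ) : ℕ :=
  z.2.2 - z.2.1 + if z.1.2 then 1 else 0

/-- The exponent of the sign of an interval cut: the Koszul sign of the permutation that sorts the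
intervals by their labels, and the sum of the end positions of the intervals whose label occurs
again later. -/
def cutExponent {r : ℕ} : List ((Fin r × Bool) × ℕ × ℕ) → ℕ
  | [] => 0
  | z :: c => ((c.filter fun z' => z'.1.1 < z.1.1).map fun z' => cutDegree z * cutDegree z').sum
      + (if z.1.2 then z.2.2 else 0) + cutExponent c

/-- The coefficients of the action `E r ⊗ N_*(K) → N_*(K)^{⊗ r}` of the Barratt–Eccles operad on
normalized simplicial chains (Berger–Fresse): for a simplex `ws` of `E r` and an `n`-simplex `x` of
a simplicial set `K`, the chain `ws(x)` is the sum over all families `θ` of monotone maps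
`θ i : [q i] → [n]` of this integer times `θ_0^* x ⊗ ⋯ ⊗ θ_{r-1}^* x`. -/
def coactionCoeff {r : ℕ} (ws : List (List (Fin r))) (n : ℕ) (θ : Fin r → List ℕ) : ℤ :=
  ((((tableReduction ws).flatMap (intervalCuts n 0)).filter
    fun c => ∀ i, cutVertices i c = θ i).map fun c => (-1) ^ cutExponent c).sum

/-- A sequence of permutations as a list of lists of values. -/
def toLists {r d : ℕ} (w : Fin (d + 1) → Equiv.Perm (Fin r)) : List (List (Fin r)) :=
  List.ofFn fun t => List.ofFn (w t)

/-- The front face `(w 0, …, w j)`. -/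
def front {r d : ℕ} (w : Fin (d + 1) → Equiv.Perm (Fin r)) (j : Fin (d + 1)) :
    Fin ((j : ℕ) + 1) → Equiv.Perm (Fin r) :=
  fun t => w ⟨t, by omega⟩

/-- The values of a monotone map between finite ordinals. -/
def mapValues {q n : ℕ} (θ : SimplexCategory.mk q ⟶ SimplexCategory.mk n) : List ℕ :=
  List.ofFn fun t => (θ.toOrderHom t : ℕ)

end BarrattEccles

open BarrattEccles

/-! ## Algebras over the Barratt–Eccles operad -/

/-- For `c = true` the differential of a complex in degree `n`, for `c = false` the identity. -/
def dSlot {k : Type u} [Field k] (X : ChainComplex (ModuleCat.{u} k) ℤ) (n : ℤ) :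
    (c : Bool) → X.X n →ₗ[k] X.X (bif c then n - 1 else n)
  | true => (X.d n (n - 1)).hom
  | false => LinearMap.id

/-- An `E_∞`-algebra in (unbounded) differential graded vector spaces over `k`: an algebra over the
Barratt–Eccles operad. The multilinear map `op w n m` is the operation given by the simplex
`w = (w 0, …, w d)` of `E r`, on arguments of degrees `n 0, …, n (r-1)`, with values in degree `m`;
as for the differentials of a complex, it is set to zero unless `m = d + ∑ i, n i`. -/
structure EInftyAlg (k : Type u) [Field k] where
  X : ChainComplex (ModuleCat.{u} k) ℤ
  op : ∀ {r d : ℕ} (_ : Fin (d + 1) → Equiv.Perm (Fin r)) (n : Fin r → ℤ) (m : ℤ),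
    MultilinearMap k (fun i => X.X (n i)) (X.X m)
  op_shape : ∀ {r d : ℕ} (w : Fin (d + 1) → Equiv.Perm (Fin r)) (n : Fin r → ℤ) (m : ℤ),
    m ≠ d + ∑ i, n i → op w n m = 0
  /-- Degenerate simplices of `E r` act by zero. -/
  op_degenerate : ∀ {r d : ℕ} (w : Fin (d + 1) → Equiv.Perm (Fin r)) (n : Fin r → ℤ) (m : ℤ),
    (∃ t : Fin d, w t.castSucc = w t.succ) → op w n m = 0
  /-- The differential of an operation by a `0`-simplex. -/
  d_op_zero : ∀ {r : ℕ} (w : Fin (0 + 1) → Equiv.Perm (Fin r)) (n : Fin r → ℤ) (m : ℤ),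
    m = ∑ i, n i → ∀ a : ∀ i, X.X (n i),
    (X.d m (m - 1)).hom (op w n m a) =
      ∑ j : Fin r, ((∑ i : Fin r, if i < j then n i else 0).negOnePow : ℤ) •
        op w (fun i => bif decide (i = j) then n i - 1 else n i) (m - 1)
          (fun i => dSlot X (n i) (decide (i = j)) (a i))
  /-- The differential of an operation by a `(d + 1)`-simplex. -/
  d_op_succ : ∀ {r d : ℕ} (w : Fin (d + 1 + 1) → Equiv.Perm (Fin r)) (n : Fin r → ℤ) (m : ℤ),
    m = (d + 1 : ℕ) + ∑ i, n i → ∀ a : ∀ i, X.X (n i),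
    (X.d m (m - 1)).hom (op w n m a) =
      ∑ t : Fin (d + 1 + 1), ((-1 : ℤ) ^ (t : ℕ)) • op (w ∘ t.succAbove) n (m - 1) a +
      ∑ j : Fin r, (((d + 1 : ℕ) + ∑ i : Fin r, if i < j then n i else 0).negOnePow : ℤ) •
        op w (fun i => bif decide (i = j) then n i - 1 else n i) (m - 1)
          (fun i => dSlot X (n i) (decide (i = j)) (a i))
  /-- The unit of the operad acts by the identity. -/
  op_unit : ∀ (n : ℤ) (a : X.X n),
    op (r := 1) (d := 0) (fun _ => 1) (fun _ => n) n (fun _ => a) = a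
  /-- Equivariance, with the Koszul sign. -/
  op_perm : ∀ {r d : ℕ} (σ : Equiv.Perm (Fin r)) (w : Fin (d + 1) → Equiv.Perm (Fin r))
    (n : Fin r → ℤ) (m : ℤ) (a : ∀ i, X.X (n i)),
    op (fun t => σ * w t) n m a =
      ((∑ i : Fin r, ∑ j : Fin r,
          if i < j ∧ σ j < σ i then n (σ i) * n (σ j) else 0).negOnePow : ℤ) •
        op w (fun i => n (σ i)) m (fun i => a (σ i))
  /-- Compatibility with the composition of the operad, which is the shuffle map followed by the
  composition of permutations. -/
  op_comp : ∀ {r d : ℕ} {s e : Fin r → ℕ} (w : Fin (d + 1) → Equiv.Perm (Fin r))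
    (v : ∀ i, Fin (e i + 1) → Equiv.Perm (Fin (s i))) (n : ∀ i, Fin (s i) → ℤ) (m : ℤ)
    (a : ∀ i q, X.X (n i q)),
    op w (fun i => e i + ∑ q, n i q) m (fun i => op (v i) (n i) (e i + ∑ q, n i q) (a i)) =
      ((∑ i : Fin r, ∑ j : Fin r,
          if j < i then (e i : ℤ) * ∑ q, n j q else 0).negOnePow : ℤ) •
        ∑ x : Shuffle (compDims d e) (d + ∑ i, e i), ((-1 : ℤ) ^ shuffleExponent x) •
          op (compSimplex w v x)
            (fun p => n (finSigmaFinEquiv.symm p).1 (finSigmaFinEquiv.symm p).2) m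
            (fun p => a (finSigmaFinEquiv.symm p).1 (finSigmaFinEquiv.symm p).2)

namespace EInftyAlg

variable {k : Type u} [Field k]

/-- Morphisms of `E_∞`-algebras: chain maps that commute with all operations. -/
@[ext]
structure Hom (A B : EInftyAlg k) where
  hom : A.X ⟶ B.X
  map_op : ∀ {r d : ℕ} (w : Fin (d + 1) → Equiv.Perm (Fin r)) (n : Fin r → ℤ) (m : ℤ)
    (a : ∀ i, A.X.X (n i)),
    (hom.f m).hom (A.op w n m a) = B.op w n m (fun i => (hom.f (n i)).hom (a i))

instance : Category (EInftyAlg k) where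
  Hom := Hom
  id A := ⟨𝟙 A.X, fun w n m a => by simp⟩
  comp f g := ⟨f.hom ≫ g.hom, fun w n m a => by simp [f.map_op, g.map_op]⟩

/-- The underlying function of a morphism in degree `n`. -/
def ap {A B : EInftyAlg k} (f : A ⟶ B) (n : ℤ) (a : A.X.X n) : B.X.X n := (f.hom.f n).hom a

@[simp] lemma ap_id (A : EInftyAlg k) (n : ℤ) (a : A.X.X n) : ap (𝟙 A) n a = a := rfl

@[simp] lemma ap_comp {A B C : EInftyAlg k} (f : A ⟶ B) (g : B ⟶ C) (n : ℤ) (a : A.X.X n) :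
    ap (f ≫ g) n a = ap g n (ap f n a) := rfl

lemma hom_ext {A B : EInftyAlg k} {f g : A ⟶ B} (h : ∀ n a, ap f n a = ap g n a) : f = g := by
  apply Hom.ext
  ext n a
  exact h n a

/-- A function between the underlying graded sets is a morphism of `E_∞`-algebras. -/
structure IsAlgMap (A B : EInftyAlg k) (φ : ∀ n, A.X.X n → B.X.X n) : Prop where
  add : ∀ n a a', φ n (a + a') = φ n a + φ n a'
  smul : ∀ n (c : k) a, φ n (c • a) = c • φ n a
  d : ∀ i j a, φ j ((A.X.d i j).hom a) = (B.X.d i j).hom (φ i a)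
  op : ∀ {r d : ℕ} (w : Fin (d + 1) → Equiv.Perm (Fin r)) (n : Fin r → ℤ) (m : ℤ)
    (a : ∀ i, A.X.X (n i)), φ m (A.op w n m a) = B.op w n m (fun i => φ (n i) (a i))

lemma isAlgMap_ap {A B : EInftyAlg k} (f : A ⟶ B) : IsAlgMap A B (ap f) where
  add n a a' := map_add (f.hom.f n).hom a a'
  smul n c a := map_smul (f.hom.f n).hom c a
  d i j a := by
    have := f.hom.comm i j
    exact (congrArg (fun g => g.hom a) this).symm
  op w n m a := f.map_op w n m a

/-- The morphism given by a function as in `IsAlgMap`. -/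
def IsAlgMap.toHom {A B : EInftyAlg k} {φ : ∀ n, A.X.X n → B.X.X n} (h : IsAlgMap A B φ) :
    A ⟶ B where
  hom :=
    { f := fun n => ModuleCat.ofHom
        { toFun := φ n, map_add' := h.add n, map_smul' := fun c a => h.smul n c a }
      comm' := fun i j _ => by
        ext a
        exact (h.d i j a).symm }
  map_op w n m a := h.op w n m a

@[simp] lemma IsAlgMap.ap_toHom {A B : EInftyAlg k} {φ : ∀ n, A.X.X n → B.X.X n}
    (h : IsAlgMap A B φ) (n : ℤ) (a : A.X.X n) : ap h.toHom n a = φ n a := rfl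

/-- Weak equivalences: the quasi-isomorphisms. -/
def IsWeakEquivalence {A B : EInftyAlg k} (f : A ⟶ B) : Prop := QuasiIso f.hom

/-- Fibrations: the degreewise surjections. -/
def IsFibration {A B : EInftyAlg k} (f : A ⟶ B) : Prop :=
  ∀ n, Function.Surjective (ap f n)

/-- Cofibrant objects: morphisms out of them lift along all trivial fibrations. -/
def IsCofibrant (A : EInftyAlg k) : Prop :=
  ∀ ⦃B C : EInftyAlg k⦄ (p : B ⟶ C), IsFibration p → IsWeakEquivalence p →
    ∀ f : A ⟶ C, ∃ g : A ⟶ B, g ≫ p = f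

/-! ### Algebras given by generators and relations -/

/-- Formal expressions in generators `Γ` by the structure of an `E_∞`-algebra. -/
inductive Term (k : Type u) (Γ : ℤ → Type u) : ℤ → Type u
  | gen {n : ℤ} (g : Γ n) : Term k Γ n
  | zero (n : ℤ) : Term k Γ n
  | add {n : ℤ} (s t : Term k Γ n) : Term k Γ n
  | smul {n : ℤ} (c : k) (t : Term k Γ n) : Term k Γ n
  | d {i : ℤ} (j : ℤ) (t : Term k Γ i) : Term k Γ j
  | op {r d : ℕ} (w : Fin (d + 1) → Equiv.Perm (Fin r)) (n : Fin r → ℤ) (m : ℤ)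
      (t : ∀ i, Term k Γ (n i)) : Term k Γ m

/-- The value of an expression in an algebra, for given values of the generators. -/
def Term.eval {Γ : ℤ → Type u} (B : EInftyAlg k) (f : ∀ n, Γ n → B.X.X n) :
    ∀ {n : ℤ}, Term k Γ n → B.X.X n
  | _, .gen g => f _ g
  | _, .zero _ => 0
  | _, .add s t => s.eval B f + t.eval B f
  | _, .smul c t => c • t.eval B f
  | _, .d j t => (B.X.d _ j).hom (t.eval B f)
  | _, .op w n m t => B.op w n m (fun i => (t i).eval B f)

section Universal

variable {Γ : ℤ → Type u} (R : ∀ B : EInftyAlg k, (∀ n, Γ n → B.X.X n) → Prop)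

/-- Two expressions are identified if they have the same value in every algebra, for all values of
the generators that satisfy the relations `R`. -/
def termSetoid (n : ℤ) : Setoid (Term k Γ n) where
  r s t := ∀ (B : EInftyAlg k) (f : ∀ n, Γ n → B.X.X n), R B f → s.eval B f = t.eval B f
  iseqv := ⟨fun _ _ _ _ => rfl, fun h B f hf => (h B f hf).symm,
    fun h h' B f hf => (h B f hf).trans (h' B f hf)⟩

/-- Expressions in the generators modulo the relations. -/
def Univ (n : ℤ) : Type u := Quotient (termSetoid R n)

namespace Univ

variable {R}

/-- The value of a class of expressions. -/
def eval {B : EInftyAlg k} {f : ∀ n, Γ n → B.X.X n} (hf : R B f) {n : ℤ} :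
    Univ R n → B.X.X n :=
  Quotient.lift (fun t => t.eval B f) (fun _ _ h => h B f hf)

lemma ext {n : ℤ} {x y : Univ R n}
    (h : ∀ (B : EInftyAlg k) (f : ∀ n, Γ n → B.X.X n) (hf : R B f), eval hf x = eval hf y) :
    x = y := by
  induction x using Quotient.inductionOn with | h s =>
  induction y using Quotient.inductionOn with | h t =>
  exact Quotient.sound fun B f hf => h B f hf

/-- The class of an expression. -/
def mk {n : ℤ} (t : Term k Γ n) : Univ R n := Quotient.mk _ t

@[simp] lemma eval_mk {B : EInftyAlg k} {f : ∀ n, Γ n → B.X.X n} (hf : R B f) {n : ℤ}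
    (t : Term k Γ n) : eval hf (mk t) = t.eval B f := rfl

/-- The generators. -/
def gen {n : ℤ} (g : Γ n) : Univ R n := mk (.gen g)

@[simp] lemma eval_gen {B : EInftyAlg k} {f : ∀ n, Γ n → B.X.X n} (hf : R B f) {n : ℤ}
    (g : Γ n) : eval hf (gen g) = f n g := rfl

instance (n : ℤ) : Zero (Univ R n) := ⟨Quotient.mk _ (.zero n)⟩
noncomputable instance (n : ℤ) : Add (Univ R n) := ⟨fun x y => Quotient.mk _ (.add x.out y.out)⟩
noncomputable instance (n : ℤ) : SMul k (Univ R n) := ⟨fun c x => Quotient.mk _ (.smul c x.out)⟩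
noncomputable instance (n : ℤ) : Neg (Univ R n) := ⟨fun x => (-1 : k) • x⟩

/-- The differential on classes of expressions. -/
noncomputable def d (i j : ℤ) (x : Univ R i) : Univ R j := Quotient.mk _ (.d j x.out)

/-- The operations on classes of expressions. -/
noncomputable def op {r d : ℕ} (w : Fin (d + 1) → Equiv.Perm (Fin r)) (n : Fin r → ℤ) (m : ℤ)
    (x : ∀ i, Univ R (n i)) : Univ R m :=
  Quotient.mk _ (.op w n m fun i => (x i).out)

section

variable {B : EInftyAlg k} {f : ∀ n, Γ n → B.X.X n} (hf : R B f)

lemma eval_out {n : ℤ} (x : Univ R n) : (Quotient.out x).eval B f = eval hf x := by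
  conv_rhs => rw [← Quotient.out_eq x]
  rfl

@[simp] lemma eval_zero (n : ℤ) : eval hf (0 : Univ R n) = 0 := rfl

@[simp] lemma eval_add {n : ℤ} (x y : Univ R n) : eval hf (x + y) = eval hf x + eval hf y := by
  rw [← eval_out hf x, ← eval_out hf y]; rfl

@[simp] lemma eval_smul {n : ℤ} (c : k) (x : Univ R n) : eval hf (c • x) = c • eval hf x := by
  rw [← eval_out hf x]; rfl

@[simp] lemma eval_neg {n : ℤ} (x : Univ R n) : eval hf (-x) = -eval hf x := by
  change eval hf ((-1 : k) • x) = _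
  simp

@[simp] lemma eval_d (i j : ℤ) (x : Univ R i) :
    eval hf (d i j x) = (B.X.d i j).hom (eval hf x) := by
  rw [← eval_out hf x]; rfl

@[simp] lemma eval_op {r d : ℕ} (w : Fin (d + 1) → Equiv.Perm (Fin r)) (n : Fin r → ℤ) (m : ℤ)
    (x : ∀ i, Univ R (n i)) : eval hf (op w n m x) = B.op w n m (fun i => eval hf (x i)) := by
  have h : (fun i => eval hf (x i)) = fun i => (Quotient.out (x i)).eval B f :=
    funext fun i => (eval_out hf (x i)).symm
  rw [h]; rfl

end

noncomputable instance (n : ℤ) : AddCommGroup (Univ R n) where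
  add_assoc x y z := ext fun B f hf => by simp [add_assoc]
  zero_add x := ext fun B f hf => by simp
  add_zero x := ext fun B f hf => by simp
  add_comm x y := ext fun B f hf => by simp [add_comm]
  neg_add_cancel x := ext fun B f hf => by simp
  nsmul := nsmulRec
  zsmul := zsmulRec

noncomputable instance (n : ℤ) : Module k (Univ R n) where
  one_smul x := ext fun B f hf => by simp
  mul_smul c c' x := ext fun B f hf => by simp [mul_smul]
  smul_zero c := ext fun B f hf => by simp
  smul_add c x y := ext fun B f hf => by simp
  add_smul c c' x := ext fun B f hf => by simp [add_smul]
  zero_smul x := ext fun B f hf => by simp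

/-- Evaluation as a linear map. -/
noncomputable def evalₗ {B : EInftyAlg k} {f : ∀ n, Γ n → B.X.X n} (hf : R B f) (n : ℤ) :
    Univ R n →ₗ[k] B.X.X n where
  toFun := eval hf
  map_add' := eval_add hf
  map_smul' := eval_smul hf

@[simp] lemma eval_zsmul {B : EInftyAlg k} {f : ∀ n, Γ n → B.X.X n} (hf : R B f) {n : ℤ} (c : ℤ)
    (x : Univ R n) : eval hf (c • x) = c • eval hf x := map_zsmul (evalₗ hf n) c x

@[simp] lemma eval_sum {B : EInftyAlg k} {f : ∀ n, Γ n → B.X.X n} (hf : R B f) {n : ℤ} {ι : Type*}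
    (s : Finset ι) (x : ι → Univ R n) : eval hf (∑ i ∈ s, x i) = ∑ i ∈ s, eval hf (x i) :=
  map_sum (evalₗ hf n) x s

variable (R) in
/-- The underlying complex. -/
noncomputable def complex : ChainComplex (ModuleCat.{u} k) ℤ where
  X n := ModuleCat.of k (Univ R n)
  d i j := ModuleCat.ofHom
    { toFun := d i j
      map_add' := fun x y => ext fun B f hf => by simp
      map_smul' := fun c x => ext fun B f hf => by simp }
  shape i j h := by
    ext x
    exact ext fun B f hf => by
      change eval hf (d i j x) = 0
      rw [eval_d, B.X.shape i j h]; rfl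
  d_comp_d' i j l _ _ := by
    ext x
    exact ext fun B f hf => by
      change eval hf (d j l (d i j x)) = 0
      rw [eval_d, eval_d, ← ModuleCat.comp_apply, B.X.d_comp_d]; rfl

lemma eval_dSlot {B : EInftyAlg k} {f : ∀ n, Γ n → B.X.X n} (hf : R B f) (n : ℤ) (c : Bool)
    (x : Univ R n) :
    eval hf (dSlot (complex R) n c x : Univ R (bif c then n - 1 else n)) =
      dSlot B.X n c (eval hf x) := by
  cases c
  · rfl
  · exact eval_d hf _ _ x

/-- The operations as multilinear maps. -/
noncomputable def opₗ {r d : ℕ} (w : Fin (d + 1) → Equiv.Perm (Fin r)) (n : Fin r → ℤ) (m : ℤ) :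
    MultilinearMap k (fun i => Univ R (n i)) (Univ R m) where
  toFun := op w n m
  map_update_add' x i a b := ext fun B f hf => by
    simp only [eval_op, eval_add, Function.apply_update (fun i => eval hf (n := n i))]
    exact (B.op w n m).map_update_add _ _ _ _
  map_update_smul' x i c a := ext fun B f hf => by
    simp only [eval_op, eval_smul, Function.apply_update (fun i => eval hf (n := n i))]
    exact (B.op w n m).map_update_smul _ _ _ _

end Univ

/-- The `E_∞`-algebra with generators `Γ` and relations `R`. -/
noncomputable def univAlg : EInftyAlg k where
  X := Univ.complex R
  op w n m := Univ.opₗ w n m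
  op_shape w n m h := by
    ext x
    exact Univ.ext fun B f hf => by
      change Univ.eval hf (Univ.op w n m x) = 0
      rw [Univ.eval_op, B.op_shape w n m h]; rfl
  op_degenerate w n m h := by
    ext x
    exact Univ.ext fun B f hf => by
      change Univ.eval hf (Univ.op w n m x) = 0
      rw [Univ.eval_op, B.op_degenerate w n m h]; rfl
  d_op_zero w n m h a := Univ.ext fun B f hf => by
    refine (Univ.eval_d hf _ _ (Univ.op w n m a)).trans ?_
    refine (congrArg _ (Univ.eval_op hf w n m a)).trans ((B.d_op_zero w n m h _).trans ?_)
    refine Eq.trans ?_ (Univ.eval_sum hf _ _).symm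
    refine Finset.sum_congr rfl fun j _ => ?_
    refine Eq.trans ?_ (Univ.eval_zsmul hf _ _).symm
    refine congrArg _ (Eq.trans ?_ (Univ.eval_op hf _ _ _ _).symm)
    exact congrArg _ (funext fun i => (Univ.eval_dSlot hf _ _ (a i)).symm)
  d_op_succ w n m h a := Univ.ext fun B f hf => by
    refine (Univ.eval_d hf _ _ (Univ.op w n m a)).trans ?_
    refine (congrArg _ (Univ.eval_op hf w n m a)).trans ((B.d_op_succ w n m h _).trans ?_)
    refine Eq.trans ?_ (Univ.eval_add hf _ _).symm
    refine congrArg₂ _ ?_ ?_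
    · refine Eq.trans ?_ (Univ.eval_sum hf _ _).symm
      refine Finset.sum_congr rfl fun j _ => ?_
      refine Eq.trans ?_ (Univ.eval_zsmul hf _ _).symm
      exact congrArg _ (Univ.eval_op hf _ _ _ _).symm
    · refine Eq.trans ?_ (Univ.eval_sum hf _ _).symm
      refine Finset.sum_congr rfl fun j _ => ?_
      refine Eq.trans ?_ (Univ.eval_zsmul hf _ _).symm
      refine congrArg _ (Eq.trans ?_ (Univ.eval_op hf _ _ _ _).symm)
      exact congrArg _ (funext fun i => (Univ.eval_dSlot hf _ _ (a i)).symm)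
  op_unit n a := Univ.ext fun B f hf =>
    (Univ.eval_op hf _ _ _ (fun _ => a)).trans (B.op_unit n _)
  op_perm σ w n m a := Univ.ext fun B f hf => by
    refine (Univ.eval_op hf _ _ _ a).trans ?_
    rw [B.op_perm σ w n m]
    refine Eq.trans ?_ (Univ.eval_zsmul hf _ _).symm
    exact congrArg _ (Univ.eval_op hf _ _ _ _).symm
  op_comp w v n m a := Univ.ext fun B f hf => by
    refine (Univ.eval_op hf w _ m _).trans ?_
    refine Eq.trans (congrArg _ (funext fun i => Univ.eval_op hf (v i) (n i) _ (a i))) ?_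
    rw [B.op_comp w v n m]
    refine Eq.trans ?_ (Univ.eval_zsmul hf _ _).symm
    refine congrArg _ ?_
    refine Eq.trans ?_ (Univ.eval_sum hf _ _).symm
    refine Finset.sum_congr rfl fun x _ => ?_
    refine Eq.trans ?_ (Univ.eval_zsmul hf _ _).symm
    exact congrArg _ (Univ.eval_op hf _ _ _ _).symm

/-- The generators, as elements of the algebra. -/
def univGen (n : ℤ) (g : Γ n) : (univAlg R).X.X n := (Univ.gen g : Univ R n)

variable {R}

/-- The morphism out of an algebra given by generators and relations. -/
noncomputable def univDesc {B : EInftyAlg k} {f : ∀ n, Γ n → B.X.X n} (hf : R B f) :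
    univAlg R ⟶ B :=
  IsAlgMap.toHom (φ := fun n (x : Univ R n) => Univ.eval hf x)
    { add := fun _ x y => Univ.eval_add hf x y
      smul := fun _ c x => Univ.eval_smul hf c x
      d := fun i j x => Univ.eval_d hf i j x
      op := fun w n m x => Univ.eval_op hf w n m x }

@[simp] lemma ap_univDesc_gen {B : EInftyAlg k} {f : ∀ n, Γ n → B.X.X n} (hf : R B f) (n : ℤ)
    (g : Γ n) : ap (univDesc hf) n (univGen R n g) = f n g := rfl

/-- Equations in an algebra given by generators and relations may be checked after evaluation. -/
lemma univ_ext {n : ℤ} {x y : (univAlg R).X.X n}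
    (h : ∀ (B : EInftyAlg k) (f : ∀ n, Γ n → B.X.X n) (hf : R B f),
      ap (univDesc hf) n x = ap (univDesc hf) n y) : x = y :=
  Univ.ext h

/-- A morphism out of an algebra given by generators and relations is determined by its values on
the generators. -/
lemma univ_hom_ext {B : EInftyAlg k} {g h : univAlg R ⟶ B}
    (H : ∀ n (γ : Γ n), ap g n (univGen R n γ) = ap h n (univGen R n γ)) : g = h := by
  have key : ∀ {n : ℤ} (t : Term k Γ n),
      ap g n (Univ.mk (R := R) t) =
        ap h n (Univ.mk (R := R) t) := by
    intro n t
    induction t with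
    | gen γ => exact H _ γ
    | zero n =>
      exact ((g.hom.f n).hom.map_zero).trans ((h.hom.f n).hom.map_zero).symm
    | @add n s t hs ht =>
      have e : (Univ.mk (R := R) (s.add t)) =
          (Univ.mk (R := R) s) + (Univ.mk (R := R) t) :=
        Univ.ext fun B f hf => by rw [Univ.eval_add]; rfl
      rw [e]
      exact ((isAlgMap_ap g).add _ _ _).trans
        ((congrArg₂ _ hs ht).trans ((isAlgMap_ap h).add _ _ _).symm)
    | @smul n c t ht =>
      have e : (Univ.mk (R := R) (t.smul c)) =
          c • (Univ.mk (R := R) t) :=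
        Univ.ext fun B f hf => by rw [Univ.eval_smul]; rfl
      rw [e]
      exact ((isAlgMap_ap g).smul _ _ _).trans
        ((congrArg _ ht).trans ((isAlgMap_ap h).smul _ _ _).symm)
    | @d i j t ht =>
      have e : (Univ.mk (R := R) (t.d j)) =
          Univ.d i j (Univ.mk (R := R) t) :=
        Univ.ext fun B f hf => by rw [Univ.eval_d]; rfl
      rw [e]
      exact ((isAlgMap_ap g).d i j _).trans
        ((congrArg _ ht).trans ((isAlgMap_ap h).d i j _).symm)
    | @op r d w n m t ht =>
      have e : (Univ.mk (R := R) (Term.op w n m t)) =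
          Univ.op w n m (fun i => Univ.mk (R := R) (t i)) :=
        Univ.ext fun B f hf => by rw [Univ.eval_op]; rfl
      rw [e]
      exact ((isAlgMap_ap g).op w n m _).trans
        ((congrArg _ (funext ht)).trans ((isAlgMap_ap h).op w n m _).symm)
  apply hom_ext
  intro n x
  obtain ⟨t, rfl⟩ := Quotient.exists_rep (s := termSetoid R n) x
  exact key t

end Universal

/-! ### Colimits -/

section Colimits

variable {J : Type u} [Category.{u} J] (F : J ⥤ EInftyAlg k)

/-- A cocone under `F`, in terms of elements. -/
def IsCoconeMap (B : EInftyAlg k) (f : ∀ n, (Σ j, (F.obj j).X.X n) → B.X.X n) : Prop :=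
  (∀ j, IsAlgMap (F.obj j) B fun n a => f n ⟨j, a⟩) ∧
    ∀ (j j' : J) (φ : j ⟶ j') (n : ℤ) (a : (F.obj j).X.X n), f n ⟨j', ap (F.map φ) n a⟩ = f n ⟨j, a⟩

lemma isAlgMap_univGen (j : J) : IsAlgMap (F.obj j) (univAlg (IsCoconeMap F))
    fun n a => univGen (IsCoconeMap F) n ⟨j, a⟩ where
  add n a a' := univ_ext fun B f hf => by
    rw [(isAlgMap_ap (univDesc hf)).add]; exact (hf.1 j).add n a a'
  smul n c a := univ_ext fun B f hf => by
    rw [(isAlgMap_ap (univDesc hf)).smul]; exact (hf.1 j).smul n c a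
  d i i' a := univ_ext fun B f hf => by
    rw [(isAlgMap_ap (univDesc hf)).d]; exact (hf.1 j).d i i' a
  op w n m a := univ_ext fun B f hf => by
    rw [(isAlgMap_ap (univDesc hf)).op]; exact (hf.1 j).op w n m a

/-- The colimit cocone, by generators and relations. -/
noncomputable def colimCocone : Limits.Cocone F where
  pt := univAlg (IsCoconeMap F)
  ι :=
    { app := fun j => (isAlgMap_univGen F j).toHom
      naturality := fun j j' φ => hom_ext fun n a => univ_ext fun _ _ hf =>
        hf.2 j j' φ n a }

/-- The universal property of the colimit cocone. -/
noncomputable def colimCoconeIsColimit : Limits.IsColimit (colimCocone F) where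
  desc s := univDesc (R := IsCoconeMap F) (f := fun n a => ap (s.ι.app a.1) n a.2)
    ⟨fun j => isAlgMap_ap (s.ι.app j), fun j j' φ n a => by
      change ap (F.map φ ≫ s.ι.app j') n a = ap (s.ι.app j) n a
      rw [s.w φ]⟩
  fac s j := rfl
  uniq s m h := univ_hom_ext fun n a => by
    change ap ((colimCocone F).ι.app a.1 ≫ m) n a.2 = _
    rw [h]; rfl

end Colimits

instance : Limits.HasColimits (EInftyAlg k) where
  has_colimits_of_shape _ _ :=
    { has_colimit := fun F => ⟨⟨⟨colimCocone F, colimCoconeIsColimit F⟩⟩⟩ }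

/-! ### The tensoring over simplicial sets -/

instance (q p : ℕ) : Finite (SimplexCategory.mk q ⟶ SimplexCategory.mk p) :=
  Finite.of_injective (fun θ => fun t => θ.toOrderHom t) fun θ θ' h => by
    ext t : 3
    exact congrFun h t

noncomputable instance (q p : ℕ) : Fintype (SimplexCategory.mk q ⟶ SimplexCategory.mk p) :=
  Fintype.ofFinite _

/-- The `p`-simplices of a simplicial set. -/
abbrev Simplices (K : SSet.{u}) (p : ℕ) : Type u := K.obj (Opposite.op (SimplexCategory.mk p))

/-- The morphisms from `A` to `B` parametrized by a simplicial set `K`, that is, the morphisms of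
`E_∞`-algebras from `A` to the cotensor `B^K = Hom(N_*(K), B)`, on which the Barratt–Eccles operad
acts through its diagonal (the Alexander–Whitney map) and its action on the normalized chains
`N_*(K)`. They are given here by the values `F x a` on `p`-simplices `x` of `K` and
elements `a` of `A` of degree `m`; they lie in degree `p + m` (in any other degree `l` the value is
set to zero). -/
structure IsParamMap (K : SSet.{u}) (A B : EInftyAlg k)
    (F : ∀ (p : ℕ) (_ : Simplices K p) (m l : ℤ), A.X.X m → B.X.X l) :
    Prop where
  shape : ∀ (p : ℕ) x (m l : ℤ) a, l ≠ p + m → F p x m l a = 0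
  add : ∀ (p : ℕ) x m l a a', F p x m l (a + a') = F p x m l a + F p x m l a'
  smul : ∀ (p : ℕ) x m l (c : k) a, F p x m l (c • a) = c • F p x m l a
  degenerate : ∀ (p : ℕ) (i : Fin (p + 1)) (y : Simplices K p) m l a,
    F (p + 1) (K.map (SimplexCategory.σ i).op y) m l a = 0
  d_zero : ∀ x (m : ℤ) a,
    (B.X.d m (m - 1)).hom (F 0 x m m a) = F 0 x (m - 1) (m - 1) ((A.X.d m (m - 1)).hom a)
  d_succ : ∀ (p : ℕ) x (m l : ℤ) a, l = (p + 1 : ℕ) + m →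
    (B.X.d l (l - 1)).hom (F (p + 1) x m l a) =
      ∑ i : Fin (p + 2), ((-1 : ℤ) ^ (i : ℕ)) •
        F p (K.map (SimplexCategory.δ i).op x) m (l - 1) a +
      ((-1 : ℤ) ^ (p + 1)) • F (p + 1) x (m - 1) (l - 1) ((A.X.d m (m - 1)).hom a)
  op : ∀ (p : ℕ) x {r d : ℕ} (w : Fin (d + 1) → Equiv.Perm (Fin r)) (n : Fin r → ℤ) (m l : ℤ)
    (a : ∀ i, A.X.X (n i)), m = d + ∑ i, n i → l = p + m →
    F p x m l (A.op w n m a) =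
      ((-1 : ℤ) ^ (p * d)) •
        ∑ j : Fin (d + 1), ∑ q : Fin r → Fin (p + 1),
          ∑ θ : ∀ i, SimplexCategory.mk (q i) ⟶ SimplexCategory.mk p,
            (coactionCoeff ((toLists w).drop j) p (fun i => mapValues (θ i)) *
              ((∑ i : Fin r, ∑ i' : Fin r,
                if i' < i then (q i : ℤ) * n i' else 0).negOnePow : ℤ)) •
              B.op (front w j) (fun i => q i + n i) l
                (fun i => F (q i) (K.map (θ i).op x) (n i) (q i + n i) (a i))

lemma IsParamMap.comp {K : SSet.{u}} {A B C : EInftyAlg k}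
    {F : ∀ (p : ℕ) (_ : Simplices K p) (m l : ℤ), A.X.X m → B.X.X l}
    (hF : IsParamMap K A B F) (g : B ⟶ C) :
    IsParamMap K A C (fun p x m l a => ap g l (F p x m l a)) where
  shape p x m l a h := by rw [hF.shape p x m l a h]; exact map_zero (g.hom.f l).hom
  add p x m l a a' := by rw [hF.add, (isAlgMap_ap g).add]
  smul p x m l c a := by rw [hF.smul, (isAlgMap_ap g).smul]
  degenerate p i y m l a := by rw [hF.degenerate]; exact map_zero (g.hom.f l).hom
  d_zero x m a := by rw [← (isAlgMap_ap g).d, hF.d_zero]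
  d_succ p x m l a h := by
    rw [← (isAlgMap_ap g).d, hF.d_succ p x m l a h]
    simp only [ap, map_add, map_sum, map_zsmul]
  op p x r d w n m l a h h' := by
    rw [hF.op p x w n m l a h h']
    simp only [ap, map_zsmul, map_sum]
    refine congrArg _ (Finset.sum_congr rfl fun j _ => Finset.sum_congr rfl fun q _ =>
      Finset.sum_congr rfl fun θ _ => congrArg _ ?_)
    exact g.map_op _ _ _ _

/-- Change of parameters: precomposition with a simplicial map and with a family of morphisms that
is constant on the components of the parameter space. -/
lemma IsParamMap.precomp {K L : SSet.{u}} {A B C : EInftyAlg k}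
    {F : ∀ (p : ℕ) (_ : Simplices L p) (m l : ℤ), B.X.X m → C.X.X l}
    (hF : IsParamMap L B C F) (f : K ⟶ L) (g : ∀ U, K.obj U → (A ⟶ B))
    (hg : ∀ ⦃U V⦄ (φ : U ⟶ V) (x : K.obj U), g V (K.map φ x) = g U x) :
    IsParamMap K A C (fun p x m l a => F p (f.app _ x) m l (ap (g _ x) m a)) where
  shape p x m l a h := hF.shape _ _ _ _ _ h
  add p x m l a a' := by rw [(isAlgMap_ap _).add, hF.add]
  smul p x m l c a := by rw [(isAlgMap_ap _).smul, hF.smul]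
  degenerate p i y m l a := by rw [NatTrans.naturality_apply, hF.degenerate]
  d_zero x m a := by rw [hF.d_zero, (isAlgMap_ap _).d]
  d_succ p x m l a h := by
    rw [hF.d_succ _ _ _ _ _ h, (isAlgMap_ap _).d]
    simp only [hg, NatTrans.naturality_apply]
  op p x r d w n m l a h h' := by
    rw [(isAlgMap_ap _).op, hF.op _ _ _ _ _ _ _ h h']
    simp only [hg, NatTrans.naturality_apply]

/-- The relations that define `K ⊗ A`. -/
def TensorRel (K : SSet.{u}) (A B : EInftyAlg k)
    (f : ∀ l : ℤ, (Σ (p : ℕ) (m : ℤ), Simplices K p × A.X.X m) → B.X.X l) :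
    Prop :=
  IsParamMap K A B fun p x m l a => f l ⟨p, m, x, a⟩

/-- The tensoring of `E_∞`-algebras over simplicial sets: morphisms from `K ⊗ A` to `B` are the
morphisms from `A` to `B` parametrized by `K`, that is, the morphisms from `A` to `B^K`. -/
noncomputable def tensor (K : SSet.{u}) (A : EInftyAlg k) : EInftyAlg k := univAlg (TensorRel K A)

/-- The element `x ⊗ a` of `K ⊗ A`. -/
def tmul (K : SSet.{u}) (A : EInftyAlg k) (p : ℕ) (x : Simplices K p)
    (m l : ℤ) (a : A.X.X m) : (tensor K A).X.X l := univGen (TensorRel K A) l ⟨p, m, x, a⟩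

/-- The morphism out of `K ⊗ A` given by a parametrized morphism. -/
noncomputable def tensorDesc {K : SSet.{u}} {A B : EInftyAlg k}
    {F : ∀ (p : ℕ) (_ : Simplices K p) (m l : ℤ), A.X.X m → B.X.X l}
    (hF : IsParamMap K A B F) : tensor K A ⟶ B :=
  univDesc (R := TensorRel K A) (f := fun l z => F z.1 z.2.2.1 z.2.1 l z.2.2.2) hF

@[simp] lemma tensorDesc_tmul {K : SSet.{u}} {A B : EInftyAlg k}
    {F : ∀ (p : ℕ) (_ : Simplices K p) (m l : ℤ), A.X.X m → B.X.X l}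
    (hF : IsParamMap K A B F) (p x m l a) :
    ap (tensorDesc hF) l (tmul K A p x m l a) = F p x m l a := rfl

lemma tensor_hom_ext {K : SSet.{u}} {A B : EInftyAlg k} {g h : tensor K A ⟶ B}
    (H : ∀ p x m l a, ap g l (tmul K A p x m l a) = ap h l (tmul K A p x m l a)) : g = h :=
  univ_hom_ext fun _ z => H z.1 z.2.2.1 z.2.1 _ z.2.2.2

lemma tensor_ext {K : SSet.{u}} {A : EInftyAlg k} {l : ℤ} {y z : (tensor K A).X.X l}
    (H : ∀ (B : EInftyAlg k) (F : ∀ (p : ℕ) (_ : Simplices K p) (m l : ℤ), A.X.X m → B.X.X l)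
      (hF : IsParamMap K A B F), ap (tensorDesc hF) l y = ap (tensorDesc hF) l z) : y = z :=
  univ_ext fun B f hf => H B (fun p x m l a => f l ⟨p, m, x, a⟩) hf

/-- The universal parametrized morphism `A → (K ⊗ A)^K`. -/
lemma isParamMap_tmul (K : SSet.{u}) (A : EInftyAlg k) :
    IsParamMap K A (tensor K A) (tmul K A) where
  shape p x m l a h := tensor_ext fun B F hF =>
    (hF.shape p x m l a h).trans (map_zero ((tensorDesc hF).hom.f l).hom).symm
  add p x m l a a' := tensor_ext fun B F hF => by
    rw [(isAlgMap_ap (tensorDesc hF)).add]; exact hF.add p x m l a a'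
  smul p x m l c a := tensor_ext fun B F hF => by
    rw [(isAlgMap_ap (tensorDesc hF)).smul]; exact hF.smul p x m l c a
  degenerate p i y m l a := tensor_ext fun B F hF =>
    (hF.degenerate p i y m l a).trans (map_zero ((tensorDesc hF).hom.f l).hom).symm
  d_zero x m a := tensor_ext fun B F hF =>
    ((isAlgMap_ap (tensorDesc hF)).d _ _ _).trans (hF.d_zero x m a)
  d_succ p x m l a h := tensor_ext fun B F hF => by
    refine ((isAlgMap_ap (tensorDesc hF)).d _ _ _).trans ((hF.d_succ p x m l a h).trans ?_)
    simp only [ap, map_add, map_sum, map_zsmul]; rfl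
  op p x r d w n m l a h h' := tensor_ext fun B F hF => by
    refine (hF.op p x w n m l a h h').trans ?_
    simp only [ap, map_zsmul, map_sum]
    refine congrArg _ (Finset.sum_congr rfl fun j _ => Finset.sum_congr rfl fun q _ =>
      Finset.sum_congr rfl fun θ _ => congrArg _ ?_)
    exact ((tensorDesc hF).map_op (front w j) (fun i => q i + n i) l
      (fun i => tmul K A (q i) (K.map (θ i).op x) (n i) (q i + n i) (a i))).symm

/-- The functoriality of the tensoring: `x ⊗ a ↦ f x ⊗ g x a`, where the morphism `g x : A ⟶ B` may
depend on the connected component of the simplex `x`. -/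
noncomputable def tensorMap {K L : SSet.{u}} {A B : EInftyAlg k} (f : K ⟶ L)
    (g : ∀ U, K.obj U → (A ⟶ B))
    (hg : ∀ ⦃U V⦄ (φ : U ⟶ V) (x : K.obj U), g V (K.map φ x) = g U x) :
    tensor K A ⟶ tensor L B :=
  tensorDesc ((isParamMap_tmul L B).precomp f g hg)

@[simp] lemma tensorMap_tmul {K L : SSet.{u}} {A B : EInftyAlg k} (f : K ⟶ L)
    (g : ∀ U, K.obj U → (A ⟶ B))
    (hg : ∀ ⦃U V⦄ (φ : U ⟶ V) (x : K.obj U), g V (K.map φ x) = g U x) (p x m l a) :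
    ap (tensorMap f g hg) l (tmul K A p x m l a) =
      tmul L B p (f.app _ x) m l (ap (g _ x) m a) := rfl

end EInftyAlg

/-! ## Spaces with group action and principal bundles -/

/-- A simplicial set with right `G`-action, as a functor from the groupoid `⋆ // Gᵒᵖ`; the morphism
`op g` acts by `p ↦ p · g`. -/
abbrev RightGSpace (G : Type u) [Group G] : Type (u + 1) := SingleObj Gᵐᵒᵖ ⥤ SSet.{u}

/-- A `G`-equivariant `E_∞`-algebra: a functor `⋆ // G ⥤ E_∞-Alg`. -/
abbrev EquivariantAlg (k : Type u) [Field k] (G : Type u) [Group G] : Type (u + 1) :=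
  SingleObj G ⥤ EInftyAlg k

namespace RightGSpace

variable {G : Type u} [Group G]

/-- The underlying simplicial set. -/
abbrev space (P : RightGSpace G) : SSet.{u} := P.obj (SingleObj.star _)

/-- The action of a group element. -/
abbrev act (P : RightGSpace G) (g : G) : P.space ⟶ P.space :=
  P.map (SingleObj.toEnd Gᵐᵒᵖ (MulOpposite.op g))

end RightGSpace

/-- A principal `G`-bundle over a simplicial set `Y`, for a discrete group `G`: a simplicial set
over `Y` with a right `G`-action that is free and transitive on the (nonempty) fibres. -/
structure PrincipalBundle (G : Type u) [Group G] (Y : SSet.{u}) where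
  total : RightGSpace G
  proj : total.space ⟶ Y
  act_proj : ∀ g : G, total.act g ≫ proj = proj
  surjective : ∀ U, Function.Surjective (proj.app U)
  torsor : ∀ U (p p' : total.space.obj U), proj.app U p = proj.app U p' →
    ∃! g : G, (total.act g).app U p = p'

namespace PrincipalBundle

variable {G : Type u} [Group G] {X Y : SSet.{u}}

/-- An isomorphism of principal bundles over the same base. -/
structure Iso (P P' : PrincipalBundle G Y) where
  iso : P.total ≅ P'.total
  comm : iso.hom.app (SingleObj.star _) ≫ P'.proj = P.proj

/-- The fibre product `X ×_Y P`. -/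
def pullbackSpace (Φ : X ⟶ Y) (P : PrincipalBundle G Y) : SSet.{u} where
  obj U := {z : X.obj U × P.total.space.obj U // Φ.app U z.1 = P.proj.app U z.2}
  map φ := ↾fun z => ⟨(X.map φ z.1.1, P.total.space.map φ z.1.2), by
    rw [NatTrans.naturality_apply, NatTrans.naturality_apply, z.2]⟩

/-- The fibre product `X ×_Y P` with the action of `G` on `P`. -/
def pullbackTotal (Φ : X ⟶ Y) (P : PrincipalBundle G Y) : RightGSpace G where
  obj _ := pullbackSpace Φ P
  map g :=
    { app := fun U => ↾fun z => ⟨(z.1.1, (P.total.map g).app U z.1.2), by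
        have h : P.proj.app U ((P.total.map g).app U z.1.2) = P.proj.app U z.1.2 :=
          congrArg (fun f : P.total.space ⟶ Y => f.app U z.1.2) (P.act_proj (MulOpposite.unop g))
        rw [h, z.2]⟩
      naturality := fun U V φ => by
        ext z
        refine Subtype.ext (Prod.ext rfl ?_)
        exact NatTrans.naturality_apply (P.total.map g) φ z.1.2 }
  map_id _ := by
    ext U z
    refine Subtype.ext (Prod.ext rfl ?_)
    exact congrArg (fun f : P.total.space ⟶ P.total.space => f.app U z.1.2) (P.total.map_id _)
  map_comp g h := by
    ext U z
    refine Subtype.ext (Prod.ext rfl ?_)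
    exact congrArg (fun f : P.total.space ⟶ P.total.space => f.app U z.1.2) (P.total.map_comp g h)

/-- The pullback bundle `Φ^* P = X ×_Y P` over `X`. -/
def pullback (Φ : X ⟶ Y) (P : PrincipalBundle G Y) : PrincipalBundle G X where
  total := pullbackTotal Φ P
  proj := { app := fun U => ↾fun z => z.1.1 }
  act_proj g := rfl
  surjective U x := by
    obtain ⟨p, hp⟩ := P.surjective U (Φ.app U x)
    exact ⟨⟨(x, p), hp.symm⟩, rfl⟩
  torsor U z z' h := by
    have h' : z.1.1 = z'.1.1 := h
    obtain ⟨g, hg, huniq⟩ := P.torsor U z.1.2 z'.1.2 (by rw [← z.2, ← z'.2, h'])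
    exact ⟨g, Subtype.ext (Prod.ext h' hg),
      fun g' hg' => huniq g' (congrArg (fun y => y.1.2) hg')⟩

/-- The canonical `G`-equivariant projection `Φ^* P ⟶ P`. -/
def pullbackProj (Φ : X ⟶ Y) (P : PrincipalBundle G Y) : (P.pullback Φ).total ⟶ P.total where
  app _ := { app := fun U => ↾fun z => z.1.2 }

/-- Two principal bundles over `X` lie in the same orbit of the mapping class group of `X`, which
acts on isomorphism classes of bundles by pullback along automorphisms of `X`. -/
def SameMappingClassOrbit (P P' : PrincipalBundle G X) : Prop :=
  ∃ Φ : X ≅ X, Nonempty (Iso (P.pullback Φ.hom) P')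

end PrincipalBundle

/-! ## Equivariant higher Hochschild chains -/

namespace EquivariantAlg

variable {k : Type u} [Field k] {G : Type u} [Group G]

/-- The underlying algebra. -/
abbrev alg (A : EquivariantAlg k G) : EInftyAlg k := A.obj (SingleObj.star _)

/-- The action of a group element. -/
abbrev act (A : EquivariantAlg k G) (g : G) : A.alg ⟶ A.alg := A.map (SingleObj.toEnd G g)

/-- A cofibrant replacement of `A` as an `E_∞`-algebra, on which `G` acts compatibly. -/
structure CofibrantReplacement (A : EquivariantAlg k G) where
  Q : EquivariantAlg k G
  q : Q ⟶ A
  cofibrant : Q.alg.IsCofibrant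
  weakEquivalence : EInftyAlg.IsWeakEquivalence (q.app (SingleObj.star _))

end EquivariantAlg

namespace RightGSpace

variable {k : Type u} [Field k] {G : Type u} [Group G]

/-- The group element on the edge from `i` to `j` of a string of arrows in `⋆ // G`. -/
def edge {n : ℕ} (σ : ComposableArrows (SingleObj G) n) {i j : Fin (n + 1)} (h : i ≤ j) : G :=
  σ.map (homOfLE h)

lemma edge_self {n : ℕ} (σ : ComposableArrows (SingleObj G) n) (i : Fin (n + 1)) :
    edge σ (le_refl i) = 1 := σ.map_id i

lemma edge_mul {n : ℕ} (σ : ComposableArrows (SingleObj G) n) {i j l : Fin (n + 1)} (h : i ≤ j)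
    (h' : j ≤ l) : edge σ h' * edge σ h = edge σ (h.trans h') :=
  (σ.map_comp (homOfLE h) (homOfLE h')).symm

lemma act_one (P : RightGSpace G) : P.act 1 = 𝟙 _ := P.map_id _

lemma act_mul (P : RightGSpace G) (g h : G) : P.act (g * h) = P.act g ≫ P.act h :=
  P.map_comp (X := SingleObj.star _) (Y := SingleObj.star _) (Z := SingleObj.star _) _ _

lemma _root_.EquivariantAlg.act_one (A : EquivariantAlg k G) : A.act 1 = 𝟙 _ := A.map_id _

lemma _root_.EquivariantAlg.act_mul (A : EquivariantAlg k G) (g h : G) :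
    A.act (g * h) = A.act h ≫ A.act g :=
  A.map_comp (X := SingleObj.star _) (Y := SingleObj.star _) (Z := SingleObj.star _) _ _

/-- The strings `⋆ → ⋯ → ⋆` of `m` composable arrows in `⋆ // G`, that is, the set `G^m`. -/
abbrev Strings (G : Type u) [Group G] (m : SimplexCategory) : Type u :=
  (nerve (SingleObj G)).obj (op m)

/-- The simplicial structure on strings of arrows. -/
abbrev restrict {m m' : SimplexCategory} (θ : m' ⟶ m) (σ : Strings G m) : Strings G m' :=
  (nerve (SingleObj G)).map θ.op σ

/-- The group element on the edge from the initial vertex to the image of the initial one. -/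
def initialEdge {m m' : SimplexCategory} (θ : m' ⟶ m) (σ : Strings G m) : G :=
  edge σ (Fin.zero_le (θ.toOrderHom 0))

/-- The group element on the edge from the image of the final vertex to the final one. -/
def finalEdge {m m' : SimplexCategory} (θ : m' ⟶ m) (σ : Strings G m) : G :=
  edge σ (Fin.le_last (θ.toOrderHom (Fin.last _)))

lemma initialEdge_id {m : SimplexCategory} (σ : Strings G m) : initialEdge (𝟙 m) σ = 1 :=
  edge_self σ 0

lemma finalEdge_id {m : SimplexCategory} (σ : Strings G m) : finalEdge (𝟙 m) σ = 1 :=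
  edge_self σ (Fin.last _)

lemma initialEdge_comp {m m' m'' : SimplexCategory} (θ : m' ⟶ m) (θ' : m'' ⟶ m')
    (σ : Strings G m) :
    initialEdge (θ' ≫ θ) σ = initialEdge θ' (restrict θ σ) * initialEdge θ σ :=
  (edge_mul σ (Fin.zero_le _) (θ.toOrderHom.monotone (Fin.zero_le _))).symm

lemma finalEdge_comp {m m' m'' : SimplexCategory} (θ : m' ⟶ m) (θ' : m'' ⟶ m')
    (σ : Strings G m) :
    finalEdge (θ' ≫ θ) σ = finalEdge θ σ * finalEdge θ' (restrict θ σ) :=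
  (edge_mul σ (θ.toOrderHom.monotone (Fin.le_last _)) (Fin.le_last _)).symm

/-- The standard simplices `Δ[n]`, as a functor. -/
def stdSimplices : SimplexCategory ⥤ SSet.{u} := SSet.stdSimplex.{u}

/-- The simplicial set `P × Δ[n] × G^m`, with the discrete simplicial set `G^m`. -/
def barSpace (P : RightGSpace G) (m n : SimplexCategory) : SSet.{u} where
  obj U := P.space.obj U × (stdSimplices.{u}.obj n).obj U × Strings G m
  map φ := ↾fun z => (P.space.map φ z.1, (stdSimplices.obj n).map φ z.2.1, z.2.2)

/-- The map `(p, s, σ) ↦ (f (p · g), ψ s, θ^* σ)`, where `g` is the final edge. -/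
def barSpaceMap {P P' : RightGSpace G} (f : P ⟶ P') {m m' n n' : SimplexCategory} (θ : m' ⟶ m)
    (ψ : n ⟶ n') : P.barSpace m n ⟶ P'.barSpace m' n' where
  app U := ↾fun z => ((f.app (SingleObj.star _)).app U ((P.act (finalEdge θ z.2.2)).app U z.1),
    (stdSimplices.map ψ).app U z.2.1, restrict θ z.2.2)
  naturality U V φ := by
    ext z
    refine Prod.ext ?_ (Prod.ext ?_ rfl)
    · exact (congrArg _ (NatTrans.naturality_apply (P.act (finalEdge θ z.2.2)) φ z.1)).trans
        (NatTrans.naturality_apply (f.app (SingleObj.star _)) φ _)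
    · exact NatTrans.naturality_apply (stdSimplices.map ψ) φ z.2.1

/-- The structure maps of the two-sided bar construction,
`(p, s, σ) ⊗ a ↦ (f (p · g), ψ s, θ^* σ) ⊗ h a`, where `g` is the final and `h` the initial
edge of `θ` in `σ`. -/
noncomputable def barMap (A : EquivariantAlg k G) {P P' : RightGSpace G} (f : P ⟶ P')
    {m m' n n' : SimplexCategory} (θ : m' ⟶ m) (ψ : n ⟶ n') :
    EInftyAlg.tensor (P.barSpace m n) A.alg ⟶ EInftyAlg.tensor (P'.barSpace m' n') A.alg :=
  EInftyAlg.tensorMap (barSpaceMap f θ ψ) (fun _ z => A.act (initialEdge θ z.2.2))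
    (fun _ _ _ _ => rfl)

lemma barMap_tmul (A : EquivariantAlg k G) {P P' : RightGSpace G} (f : P ⟶ P')
    {m m' n n' : SimplexCategory} (θ : m' ⟶ m) (ψ : n ⟶ n') (p : ℕ)
    (x : EInftyAlg.Simplices (P.barSpace m n) p) (l l' : ℤ) (a : A.alg.X.X l) :
    EInftyAlg.ap (barMap A f θ ψ) l' (EInftyAlg.tmul (P.barSpace m n) A.alg p x l l' a) =
      EInftyAlg.tmul (P'.barSpace m' n') A.alg p ((barSpaceMap f θ ψ).app _ x) l l'
        (EInftyAlg.ap (A.act (initialEdge θ x.2.2)) l a) := rfl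

lemma barMap_id (A : EquivariantAlg k G) (P : RightGSpace G) (m n : SimplexCategory) :
    barMap A (𝟙 P) (𝟙 m) (𝟙 n) = 𝟙 _ := by
  refine EInftyAlg.tensor_hom_ext fun p x l l' a => ?_
  have h1 : (barSpaceMap (𝟙 P) (𝟙 m) (𝟙 n)).app _ x = x := by
    refine Prod.ext ?_ (Prod.ext ?_ rfl)
    · change (P.act (finalEdge (𝟙 m) x.2.2)).app _ x.1 = x.1
      rw [finalEdge_id, act_one]; rfl
    · change (stdSimplices.map (𝟙 n)).app _ x.2.1 = x.2.1
      rw [CategoryTheory.Functor.map_id]; rfl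
  have h2 : A.act (initialEdge (𝟙 m) x.2.2) = 𝟙 _ := by
    rw [initialEdge_id, EquivariantAlg.act_one]
  rw [barMap_tmul, h1, h2, EInftyAlg.ap_id, EInftyAlg.ap_id]

lemma barMap_comp (A : EquivariantAlg k G) {P P' P'' : RightGSpace G} (f : P ⟶ P') (f' : P' ⟶ P'')
    {m m' m'' n n' n'' : SimplexCategory} (θ : m' ⟶ m) (θ' : m'' ⟶ m') (ψ : n ⟶ n')
    (ψ' : n' ⟶ n'') :
    barMap A f θ ψ ≫ barMap A f' θ' ψ' = barMap A (f ≫ f') (θ' ≫ θ) (ψ ≫ ψ') := by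
  refine EInftyAlg.tensor_hom_ext fun p x l l' a => ?_
  have h1 : (barSpaceMap f' θ' ψ').app _ ((barSpaceMap f θ ψ).app _ x) =
      (barSpaceMap (f ≫ f') (θ' ≫ θ) (ψ ≫ ψ')).app _ x := by
    refine Prod.ext ?_ (Prod.ext ?_ ?_)
    · have e := congrArg
        (fun F : P.space ⟶ P'.space => F.app (op (SimplexCategory.mk p))
          ((P.act (finalEdge θ x.2.2)).app _ x.1))
        (f.naturality (SingleObj.toEnd Gᵐᵒᵖ (MulOpposite.op (finalEdge θ' (restrict θ x.2.2)))))
      change (f'.app _).app _ ((P'.act (finalEdge θ' (restrict θ x.2.2))).app _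
        ((f.app _).app _ ((P.act (finalEdge θ x.2.2)).app _ x.1))) =
        (f'.app _).app _ ((f.app _).app _ ((P.act (finalEdge (θ' ≫ θ) x.2.2)).app _ x.1))
      rw [finalEdge_comp, act_mul]
      exact congrArg _ e.symm
    · change (stdSimplices.map ψ').app _ ((stdSimplices.map ψ).app _ x.2.1) =
        (stdSimplices.map (ψ ≫ ψ')).app _ x.2.1
      rw [CategoryTheory.Functor.map_comp]; rfl
    · rfl
  have h2 : A.act (initialEdge (θ' ≫ θ) x.2.2) =
      A.act (initialEdge θ x.2.2) ≫ A.act (initialEdge θ' (restrict θ x.2.2)) := by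
    rw [initialEdge_comp, EquivariantAlg.act_mul]
  rw [EInftyAlg.ap_comp, barMap_tmul, barMap_tmul, barMap_tmul, h1, h2, EInftyAlg.ap_comp]
  rfl

/-- The bifunctor `([m], [n]) ↦ (P × Δ[n] × G^m) ⊗ A`, contravariant in `[m]` through the two-sided
bar construction and covariant in `[n]`; it is functorial in `P`. -/
noncomputable def bar (A : EquivariantAlg k G) :
    RightGSpace G ⥤ SimplexCategoryᵒᵖ ⥤ SimplexCategory ⥤ EInftyAlg k where
  obj P :=
    { obj := fun m =>
        { obj := fun n => EInftyAlg.tensor (P.barSpace m.unop n) A.alg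
          map := fun ψ => barMap A (𝟙 P) (𝟙 m.unop) ψ
          map_id := fun n => barMap_id A P m.unop n
          map_comp := fun ψ ψ' => by rw [barMap_comp, Category.comp_id, Category.comp_id] }
      map := fun θ =>
        { app := fun n => barMap A (𝟙 P) θ.unop (𝟙 n)
          naturality := fun n n' ψ => by
            simp only [barMap_comp, Category.comp_id, Category.id_comp] }
      map_id := fun m => by
        ext n
        exact barMap_id A P m.unop n
      map_comp := fun θ θ' => by
        ext n
        simp only [NatTrans.comp_app, barMap_comp, Category.comp_id, unop_comp] }
  map f :=
    { app := fun m =>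
        { app := fun n => barMap A f (𝟙 m.unop) (𝟙 n)
          naturality := fun n n' ψ => by
            simp only [barMap_comp, Category.comp_id, Category.id_comp] }
      naturality := fun m m' θ => by
        ext n
        simp only [NatTrans.comp_app, barMap_comp, Category.comp_id, Category.id_comp] }
  map_id P := by
    ext m n
    exact barMap_id A P m.unop n
  map_comp f f' := by
    ext m n
    simp only [NatTrans.comp_app, barMap_comp, Category.comp_id]

/-- The derived tensor product `P ⊗^𝕃_G A`, functorial in the right `G`-space `P`: the coend
`∫^n (P × Δ[n] × G^n) ⊗ QA` of the bar construction, for a cofibrant replacement `QA` of `A`. -/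
noncomputable def derivedTensor {A : EquivariantAlg k G}
    (R : EquivariantAlg.CofibrantReplacement A) : RightGSpace G ⥤ EInftyAlg k :=
  bar R.Q ⋙ Limits.coendFunctor SimplexCategory (EInftyAlg k)

end RightGSpace

namespace PrincipalBundle

variable {k : Type u} [Field k] {G : Type u} [Group G] {X : SSet.{u}}

/-- The equivariant higher Hochschild chains `∫_P A = P ⊗^𝕃_G A` of a principal `G`-bundle `P` with
coefficients in a `G`-equivariant `E_∞`-algebra `A` (with chosen cofibrant replacement). -/
noncomputable def hochschild (P : PrincipalBundle G X) {A : EquivariantAlg k G}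
    (R : EquivariantAlg.CofibrantReplacement A) : EInftyAlg k :=
  (RightGSpace.derivedTensor R).obj P.total

/-- The morphism `∫_{Φ^* P} A ⟶ ∫_P A` induced by the canonical projection `Φ^* P ⟶ P`. -/
noncomputable def hochschildMap {Y : SSet.{u}} (Φ : X ⟶ Y) (P : PrincipalBundle G Y)
    {A : EquivariantAlg k G} (R : EquivariantAlg.CofibrantReplacement A) :
    (P.pullback Φ).hochschild R ⟶ P.hochschild R :=
  (RightGSpace.derivedTensor R).map (P.pullbackProj Φ)

end PrincipalBundle

/-! The object `∫_P A` is built from the right `G`-space underlying `P` alone: the map from `P` to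
its base enters neither the bar construction nor the coend. It therefore suffices to compare total
spaces. The base change of an isomorphism is an isomorphism, so for an isomorphism `Φ : X ≅ Y` the
projection `X ×_Y P ⟶ P` is an isomorphism of simplicial sets: its inverse sends `p` to `(Φ⁻¹ (π p),
p)`, where `π` is the projection of `P`. Since the projection is equivariant, it is an isomorphism
of right `G`-spaces. As bundles over one base, `Φ^* P` and `P` may well differ (take `X = Y`), but
this difference lies in the map to the base, which `∫` does not see.

The rest is functoriality. For a fixed cofibrant replacement, `derivedTensor` is a functor of the
right `G`-space (the bar construction followed by the coend), and a functor preserves isomorphisms.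
For this reason the conclusion is a strict isomorphism of `E_∞`-algebras, not merely a
quasi-isomorphism, and it holds for each choice of `QA`, the same choice being used on both sides.
The statement about mapping class group orbits follows by composing with the isomorphism that a
bundle isomorphism induces on `∫`.

The geometric content is in `bijective_pullbackProj`; `isIso_pullbackProj` passes from bijections on
simplices to an isomorphism of `G`-spaces, and `isIso_hochschildMap` applies the functor. -/

namespace PrincipalBundle

variable {G : Type u} [Group G] {X Y : SSet.{u}}

/-- The projection of a pullback bundle along an isomorphism is bijective on simplices. -/
lemma bijective_pullbackProj (Φ : X ≅ Y) (P : PrincipalBundle G Y) (U : SimplexCategoryᵒᵖ) :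
    Function.Bijective (((P.pullbackProj Φ.hom).app (SingleObj.star _)).app U) := by
  -- The isomorphism `Φ` evaluated on simplices of degree `U`: the first identity gives injectivity,
  -- the second shows that the proposed preimage lies in the fibre product.
  have inv_hom (x : X.obj U) : Φ.inv.app U (Φ.hom.app U x) = x :=
    congrArg (fun f : X ⟶ X => f.app U x) Φ.hom_inv_id
  have hom_inv (y : Y.obj U) : Φ.hom.app U (Φ.inv.app U y) = y :=
    congrArg (fun f : Y ⟶ Y => f.app U y) Φ.inv_hom_id
  constructor
  · intro z z' h
    have h' : z.1.2 = z'.1.2 := h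
    refine Subtype.ext (Prod.ext ?_ h')
    -- The base coordinate is determined by the other one: `x = Φ⁻¹ (Φ x) = Φ⁻¹ (π p)` for every
    -- simplex `(x, p)` of the fibre product, by the equation `Φ x = π p` that defines it.
    rw [← inv_hom z.1.1, ← inv_hom z'.1.1, z.2, z'.2, h']
  · intro p
    -- The only possible preimage of `p`; the condition for membership in the fibre product is `Φ
    -- (Φ⁻¹ (π p)) = π p`.
    exact ⟨⟨(Φ.inv.app U (P.proj.app U p), p), hom_inv _⟩, rfl⟩

/-- The projection `Φ^* P ⟶ P` along an isomorphism `Φ` is an isomorphism of right `G`-spaces. -/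
lemma isIso_pullbackProj (Φ : X ≅ Y) (P : PrincipalBundle G Y) :
    IsIso (P.pullbackProj Φ.hom) := by
  -- Both a right `G`-space and a simplicial set are functors, so invertibility is tested pointwise
  -- twice: at the single object of `⋆ // Gᵒᵖ`, then in each simplicial degree, where it means
  -- bijectivity. The degreewise inverses are automatically compatible with the simplicial structure
  -- and with the action, because the inverse of a natural family of isomorphisms is natural.
  have (s : SingleObj Gᵐᵒᵖ) : IsIso ((P.pullbackProj Φ.hom).app s) := by
    have (U : SimplexCategoryᵒᵖ) : IsIso (((P.pullbackProj Φ.hom).app s).app U) :=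
      -- The object `s` is arbitrary, whereas the bijectivity is stated at `SingleObj.star`; the two
      -- agree definitionally, since there is only one object.
      (isIso_iff_bijective _).2 (bijective_pullbackProj Φ P U)
    exact NatIso.isIso_of_isIso_app _
  exact NatIso.isIso_of_isIso_app _

/-- Pulling back along an isomorphism does not change equivariant higher Hochschild chains. -/
lemma isIso_hochschildMap {k : Type u} [Field k] (Φ : X ≅ Y) (P : PrincipalBundle G Y)
    {A : EquivariantAlg k G} (R : EquivariantAlg.CofibrantReplacement A) :
    IsIso (P.hochschildMap Φ.hom R) := by
  have := isIso_pullbackProj Φ P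
  -- Once the induced morphism is unfolded to the image of the projection under `derivedTensor R`,
  -- instance search finds that a functor preserves the isomorphism just obtained.
  exact inferInstanceAs (IsIso ((RightGSpace.derivedTensor R).map (P.pullbackProj Φ.hom)))

end PrincipalBundle

/-- The second part is a corollary of the first. Both sides of its conclusion use the same `R`, so
no comparison between different cofibrant replacements is needed, and the isomorphism is again one
of `E_∞`-algebras on the nose. -/
theorem proposition2p9 {k : Type u} [Field k] {G : Type u} [Group G] :
    (∀ {X Y : SSet.{u}} (Φ : X ≅ Y) (P : PrincipalBundle G Y) (A : EquivariantAlg k G)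
      (R : EquivariantAlg.CofibrantReplacement A), IsIso (P.hochschildMap Φ.hom R)) ∧
    (∀ {X : SSet.{u}} (P P' : PrincipalBundle G X), P.SameMappingClassOrbit P' →
      ∀ (A : EquivariantAlg k G) (R : EquivariantAlg.CofibrantReplacement A),
        Nonempty (P.hochschild R ≅ P'.hochschild R)) := by
  refine ⟨fun Φ P A R => PrincipalBundle.isIso_hochschildMap Φ P R, ?_⟩
  -- Lying in one orbit provides an automorphism `Φ` of `X` and a bundle isomorphism `i` from `Φ^*
  -- P` to `P'`.
  rintro X P P' ⟨Φ, ⟨i⟩⟩ A R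
  have := PrincipalBundle.isIso_hochschildMap Φ P R
  -- The zigzag `∫_P A ← ∫_{Φ^* P} A → ∫_{P'} A`: the left arrow is inverted by the first part, and
  -- the right one is the image under `derivedTensor R` of the isomorphism of total `G`-spaces
  -- underlying `i`.
  exact ⟨(asIso (P.hochschildMap Φ.hom R)).symm ≪≫ (RightGSpace.derivedTensor R).mapIso i.iso⟩
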